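/- Let $(\mathcal A;\mathcal E)$ be an exact category (in the sense of Quillen: $\mathcal A$ is additive and $\mathcal E$ is a class of kernel-cokernel pairs, called conflations, closed under isomorphism and satisfying the usual axioms on inflations and deflations). An ideal of $\mathcal A$ is an additive subbifunctor of $\mathrm{Hom}$. An ME-conflation $i\to a\to j$ of arrows is a morphism $(i,a,j)$ from a conflation $I_0\to A_0\to J_0$ to a conflation $I_1\to A_1\to J_1$ that factors as $(1_{I_0},a^1,j)$ followed by $(i,a^2,1_{J_1})$ through a conflation $I_0\to A\to J_1$; one then writes $a=i\star j$. Put $\mathrm{Ext}(j,i)=0$ if every ME-conflation $i\to a\to j$ as above is null-homotopic, that is, $a=m_1h+ge_0$ for some $h:A_0\to I_1$ and $g:J_0\to A_1$, where $m_1:I_1\to A_1$ and $e_0:A_0\to J_0$ are the given inflation and deflation. For an ideal $\mathcal I$ let $\mathcal I^\perp$ be the ideal of all morphisms $k$ with $\mathrm{Ext}(i,k)=0$ for every $i\in\mathcal I$. Let $\mathcal E\text{-inj}=\mathrm{Hom}^\perp$ be the ideal of injective morphisms. For ideals $\mathcal I,\mathcal J$ let $\mathcal I\diamond\mathcal J$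 be the smallest ideal that contains all extensions $i\star j$ with $i\in\mathcal I$ and $j\in\mathcal J$. A special $\mathcal I$-precover of an object $A$ is a morphism $i_1:C_1\to A$ in $\mathcal I$ that is the deflation of a conflation $K_1\to C_1\to A$ arising as the pushout of a conflation $K_0\to C_0\to A$ along a morphism $k:K_0\to K_1$ in $\mathcal I^\perp$; such a $k$ is called an $\mathcal I$-syzygy of $A$. The ideal $\mathcal I$ is special precovering if every object has a special $\mathcal I$-precover. An ideal $\mathcal J\subseteq\mathcal I^\perp$ is an $\mathcal I$-syzygy ideal if it contains an $\mathcal I$-syzygy of every object $A$. The category has enough injective morphisms if every object $A$ admits an inflation $A\to E$ that is an injective morphism. **Theorem.** Suppose that $(\mathcal A;\mathcal E)$ has enough injective morphisms, let $\mathcal I$ be a special precovering ideal, and let $\mathcal J\subseteq\mathcal I^\perp$ be an ideal. Then $\mathcal J$ is an $\mathcal I$-syzygy ideal if and only if $\mathcal J\diamond\mathcal E\text{-inj}=\mathcal I^\perp$. -/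

import Mathlib

open CategoryTheory CategoryTheory.Limits

universe v u

namespace IdealApprox

/-- An ideal of a preadditive category: a subgroup of every `Hom` group, such that the family is
stable under composition with arbitrary morphisms on both sides (an additive subbifunctor
of `Hom`). -/
@[ext]
structure MorphismIdeal (C : Type u) [Category.{v} C] [Preadditive C] where
  hom (X Y : C) : AddSubgroup (X ⟶ Y)
  comp_mem : ∀ {W X Y Z : C} (h : W ⟶ X) (g : X ⟶ Y) (f : Y ⟶ Z),
    g ∈ hom X Y → h ≫ g ≫ f ∈ hom W Z

namespace MorphismIdeal

variable {C : Type u} [Category.{v} C] [Preadditive C]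

/-- Inclusion of ideals. -/
instance : LE (MorphismIdeal C) where
  le I J := ∀ ⦃X Y : C⦄ (f : X ⟶ Y), f ∈ I.hom X Y → f ∈ J.hom X Y

/-- The ideal `Hom` of all morphisms. -/
def all (C : Type u) [Category.{v} C] [Preadditive C] : MorphismIdeal C where
  hom _ _ := ⊤
  comp_mem _ _ _ _ := AddSubgroup.mem_top _

/-- The smallest ideal containing a class `M` of morphisms: the intersection of all ideals
that contain `M`. -/
def span (M : MorphismProperty C) : MorphismIdeal C where
  hom X Y := ⨅ K : {K : MorphismIdeal C // ∀ ⦃A B : C⦄ (f : A ⟶ B), M f → f ∈ K.hom A B},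
    K.1.hom X Y
  comp_mem h g f hg := by
    rw [AddSubgroup.mem_iInf] at hg ⊢
    exact fun K => K.1.comp_mem h g f (hg K)

end MorphismIdeal

section Pairs

variable {C : Type u} [Category.{v} C] [Preadditive C] (P : ObjectProperty (ShortComplex C))

/-- The pair `A --m--> B --e--> D` belongs to the class `P` of short complexes. -/
def IsPairIn {A B D : C} (m : A ⟶ B) (e : B ⟶ D) : Prop :=
  ∃ w : m ≫ e = 0, P (ShortComplex.mk m e w)

/-- `m` is the first morphism of a pair in `P`. -/
def IsInflationIn {A B : C} (m : A ⟶ B) : Prop := ∃ (D : C) (e : B ⟶ D), IsPairIn P m e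

/-- `e` is the second morphism of a pair in `P`. -/
def IsDeflationIn {B D : C} (e : B ⟶ D) : Prop := ∃ (A : C) (m : A ⟶ B), IsPairIn P m e

end Pairs

/-- A (Quillen) exact structure on an additive category: a class of kernel-cokernel pairs, the
conflations, closed under isomorphism and satisfying the usual axioms on inflations (the first
morphisms of the conflations) and deflations (the second morphisms of the conflations). -/
structure ExactStructure (C : Type u) [Category.{v} C] [Preadditive C]
    [HasFiniteBiproducts C] where
  conflations : ObjectProperty (ShortComplex C)
  of_iso : ∀ {S T : ShortComplex C}, (S ≅ T) → conflations S → conflations T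
  isKernel : ∀ S : ShortComplex C, conflations S →
    Nonempty (IsLimit (KernelFork.ofι S.f S.zero))
  isCokernel : ∀ S : ShortComplex C, conflations S →
    Nonempty (IsColimit (CokernelCofork.ofπ S.g S.zero))
  id_inflation : ∀ A : C, IsInflationIn conflations (𝟙 A)
  id_deflation : ∀ A : C, IsDeflationIn conflations (𝟙 A)
  comp_inflation : ∀ {A B D : C} (m : A ⟶ B) (n : B ⟶ D),
    IsInflationIn conflations m → IsInflationIn conflations n →
      IsInflationIn conflations (m ≫ n)
  comp_deflation : ∀ {A B D : C} (e : A ⟶ B) (f : B ⟶ D),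
    IsDeflationIn conflations e → IsDeflationIn conflations f →
      IsDeflationIn conflations (e ≫ f)
  pushout_inflation : ∀ {A B A' : C} (m : A ⟶ B) (f : A ⟶ A'), IsInflationIn conflations m →
    ∃ (B' : C) (g : B ⟶ B') (m' : A' ⟶ B'),
      IsPushout m f g m' ∧ IsInflationIn conflations m'
  pullback_deflation : ∀ {B D D' : C} (e : B ⟶ D) (f : D' ⟶ D), IsDeflationIn conflations e →
    ∃ (B' : C) (g : B' ⟶ B) (e' : B' ⟶ D'),
      IsPullback g e' e f ∧ IsDeflationIn conflations e'

namespace ExactStructure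

variable {C : Type u} [Category.{v} C] [Preadditive C] [HasFiniteBiproducts C]
  (E : ExactStructure C)

/-- `A --m--> B --e--> D` is a conflation. -/
def IsConflation {A B D : C} (m : A ⟶ B) (e : B ⟶ D) : Prop := IsPairIn E.conflations m e

/-- `m` is an inflation. -/
def IsInflation {A B : C} (m : A ⟶ B) : Prop := IsInflationIn E.conflations m

/-- A mono-epi (ME) conflation `i ⟶ a ⟶ j` of arrows: a morphism `(i, a, j)` of conflations
```
I₀ --m₀--> A₀ --e₀--> J₀
|i         |a         |j
I₁ --m₁--> A₁ --e₁--> J₁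
```
that factors as `(𝟙, b, j)` followed by `(i, c, 𝟙)` through a conflation
`I₀ --m--> A --e--> J₁`. -/
structure IsMEConflation {I₀ I₁ A₀ A₁ J₀ J₁ : C} (i : I₀ ⟶ I₁) (a : A₀ ⟶ A₁) (j : J₀ ⟶ J₁)
    (m₀ : I₀ ⟶ A₀) (e₀ : A₀ ⟶ J₀) (m₁ : I₁ ⟶ A₁) (e₁ : A₁ ⟶ J₁) : Prop where
  top : E.IsConflation m₀ e₀
  bot : E.IsConflation m₁ e₁
  comm_left : m₀ ≫ a = i ≫ m₁
  comm_right : a ≫ e₁ = e₀ ≫ j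
  factor : ∃ (A : C) (m : I₀ ⟶ A) (e : A ⟶ J₁) (b : A₀ ⟶ A) (c : A ⟶ A₁),
    E.IsConflation m e ∧ m₀ ≫ b = m ∧ b ≫ e = e₀ ≫ j ∧ m ≫ c = i ≫ m₁ ∧ c ≫ e₁ = e ∧
      b ≫ c = a

/-- `a = i ⋆ j`: the arrow `a` is an extension of `j` by `i`. -/
def IsExtension {I₀ I₁ A₀ A₁ J₀ J₁ : C} (i : I₀ ⟶ I₁) (a : A₀ ⟶ A₁) (j : J₀ ⟶ J₁) : Prop :=
  ∃ (m₀ : I₀ ⟶ A₀) (e₀ : A₀ ⟶ J₀) (m₁ : I₁ ⟶ A₁) (e₁ : A₁ ⟶ J₁),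
    E.IsMEConflation i a j m₀ e₀ m₁ e₁

/-- The class `I ⋆ J` of all extensions `i ⋆ j` with `i` in `I` and `j` in `J`. -/
def starClass (I J : MorphismIdeal C) : MorphismProperty C := fun A₀ A₁ a =>
  ∃ (I₀ I₁ J₀ J₁ : C) (i : I₀ ⟶ I₁) (j : J₀ ⟶ J₁),
    i ∈ I.hom I₀ I₁ ∧ j ∈ J.hom J₀ J₁ ∧ E.IsExtension i (A₀ := A₀) (A₁ := A₁) a j

/-- The extension ideal `I ⋄ J`, generated by the extensions `i ⋆ j`, `i ∈ I` and `j ∈ J`. -/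
def diamond (I J : MorphismIdeal C) : MorphismIdeal C := MorphismIdeal.span (E.starClass I J)

/-- `Ext (j, i) = 0`: every ME-conflation `i ⟶ a ⟶ j` is null-homotopic. -/
def ExtOrthogonal {J₀ J₁ I₀ I₁ : C} (j : J₀ ⟶ J₁) (i : I₀ ⟶ I₁) : Prop :=
  ∀ ⦃A₀ A₁ : C⦄ (a : A₀ ⟶ A₁) (m₀ : I₀ ⟶ A₀) (e₀ : A₀ ⟶ J₀) (m₁ : I₁ ⟶ A₁) (e₁ : A₁ ⟶ J₁),
    E.IsMEConflation i a j m₀ e₀ m₁ e₁ →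
      ∃ (h : A₀ ⟶ I₁) (g : J₀ ⟶ A₁), a = h ≫ m₁ + e₀ ≫ g

variable {E} in
lemma IsConflation.mono {A B D : C} {m : A ⟶ B} {e : B ⟶ D} (h : E.IsConflation m e) :
    Mono m := by
  obtain ⟨w, h⟩ := h
  obtain ⟨hl⟩ := E.isKernel _ h
  exact Fork.IsLimit.mono hl

variable {E} in
lemma IsConflation.exists_desc {A B D T : C} {m : A ⟶ B} {e : B ⟶ D}
    (h : E.IsConflation m e) (f : B ⟶ T) (hf : m ≫ f = 0) : ∃ g : D ⟶ T, e ≫ g = f := by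
  obtain ⟨w, h⟩ := h
  obtain ⟨hc⟩ := E.isCokernel _ h
  obtain ⟨g, hg⟩ := CokernelCofork.IsColimit.desc' hc f hf
  exact ⟨g, hg⟩

variable {E} in
lemma IsConflation.epi {A B D : C} {m : A ⟶ B} {e : B ⟶ D} (h : E.IsConflation m e) :
    Epi e := by
  obtain ⟨w, h⟩ := h
  obtain ⟨hc⟩ := E.isCokernel _ h
  exact Cofork.IsColimit.epi hc

variable {E} in
/-- The pushout of a conflation along an arbitrary morphism. -/
lemma IsConflation.exists_pushout {A B D A' : C} {m : A ⟶ B} {e : B ⟶ D}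
    (h : E.IsConflation m e) (f : A ⟶ A') :
    ∃ (B' : C) (g : B ⟶ B') (m' : A' ⟶ B') (e' : B' ⟶ D),
      IsPushout m f g m' ∧ g ≫ e' = e ∧ E.IsConflation m' e' := by
  obtain ⟨B', g, m', sq, D', d, hd⟩ := E.pushout_inflation m f ⟨D, e, h⟩
  have hd' : E.IsConflation m' d := hd
  have hme : m ≫ e = 0 := h.choose
  have hmd : m' ≫ d = 0 := hd.choose
  let e' : B' ⟶ D := sq.desc e 0 (by simp [hme])
  have h1 : g ≫ e' = e := sq.inl_desc _ _ _
  have h2 : m' ≫ e' = 0 := sq.inr_desc _ _ _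
  have hepi := h.epi
  have hdepi := hd'.epi
  obtain ⟨p, hp⟩ := hd'.exists_desc e' h2
  obtain ⟨q, hq⟩ := h.exists_desc (g ≫ d) (by
    rw [← Category.assoc, sq.w, Category.assoc, hmd, comp_zero])
  have hq' : e' ≫ q = d := by
    apply sq.hom_ext
    · rw [← Category.assoc, h1, hq]
    · rw [← Category.assoc, h2, hmd, zero_comp]
  have hpq : p ≫ q = 𝟙 D' := by
    rw [← cancel_epi d, ← Category.assoc, hp, hq', Category.comp_id]
  have hqp : q ≫ p = 𝟙 D := by
    rw [← cancel_epi e, ← Category.assoc, hq, Category.assoc, hp, h1, Category.comp_id]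
  refine ⟨B', g, m', e', sq, h1, h2, ?_⟩
  let t : D' ≅ D := ⟨p, q, hpq, hqp⟩
  exact E.of_iso (S := ShortComplex.mk m' d hmd) (T := ShortComplex.mk m' e' h2)
    (ShortComplex.isoMk (Iso.refl _) (Iso.refl _) t (by simp) (by simp [t, hp]))
    hd.choose_spec

/-- `Ext (j, i) = 0` if and only if `i` extends along the pullback along `j` of every inflation
with source `I₀` whose cokernel is the target of `j`. -/
lemma extOrthogonal_iff {J₀ J₁ I₀ I₁ : C} (j : J₀ ⟶ J₁) (i : I₀ ⟶ I₁) :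
    E.ExtOrthogonal j i ↔
      ∀ ⦃A₀ A : C⦄ (m₀ : I₀ ⟶ A₀) (e₀ : A₀ ⟶ J₀) (m : I₀ ⟶ A) (e : A ⟶ J₁) (b : A₀ ⟶ A),
        E.IsConflation m₀ e₀ → E.IsConflation m e → m₀ ≫ b = m → b ≫ e = e₀ ≫ j →
          ∃ h : A₀ ⟶ I₁, m₀ ≫ h = i := by
  constructor
  · intro H A₀ A m₀ e₀ m e b h₀ h hm he
    obtain ⟨A₁, c, m₁, e₁, sq, he₁, h₁⟩ := h.exists_pushout i
    obtain ⟨k, g, hkg⟩ := H (b ≫ c) m₀ e₀ m₁ e₁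
      ⟨h₀, h₁, by rw [← Category.assoc, hm, sq.w], by rw [Category.assoc, he₁, he],
        A, m, e, b, c, h, hm, he, sq.w, he₁, rfl⟩
    have := h₁.mono
    refine ⟨k, ?_⟩
    rw [← cancel_mono m₁]
    have w₀ : m₀ ≫ e₀ = 0 := h₀.choose
    have := congrArg (fun t => m₀ ≫ t) hkg
    simp only [Preadditive.comp_add, ← Category.assoc, hm, w₀, zero_comp, add_zero] at this
    rw [← this, sq.w]
  · intro H A₀ A₁ a m₀ e₀ m₁ e₁ h
    obtain ⟨A, m, e, b, c, hc, hm, he, -, -, -⟩ := h.factor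
    obtain ⟨k, hk⟩ := H m₀ e₀ m e b h.top hc hm he
    obtain ⟨g, hg⟩ := h.top.exists_desc (a - k ≫ m₁) (by
      rw [Preadditive.comp_sub, h.comm_left, ← Category.assoc, hk, sub_self])
    exact ⟨k, g, by rw [hg]; abel⟩

/-- The right perpendicular ideal: all morphisms `i` such that `Ext (j, i) = 0` for every `j`
in `I`. -/
def perp (I : MorphismIdeal C) : MorphismIdeal C where
  hom X Y :=
    { carrier := {i | ∀ ⦃J₀ J₁ : C⦄ (j : J₀ ⟶ J₁), j ∈ I.hom J₀ J₁ → E.ExtOrthogonal j i}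
      zero_mem' := fun J₀ J₁ j _ =>
        (E.extOrthogonal_iff j _).2 fun _ _ _ _ _ _ _ _ _ _ _ => ⟨0, comp_zero⟩
      add_mem' := fun {i i'} hi hi' J₀ J₁ j hj =>
        (E.extOrthogonal_iff j _).2 fun A₀ A m₀ e₀ m e b h₀ h h1 h2 => by
          obtain ⟨k, hk⟩ := (E.extOrthogonal_iff j _).1 (hi j hj) m₀ e₀ m e b h₀ h h1 h2
          obtain ⟨k', hk'⟩ := (E.extOrthogonal_iff j _).1 (hi' j hj) m₀ e₀ m e b h₀ h h1 h2
          exact ⟨k + k', by rw [Preadditive.comp_add, hk, hk']⟩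
      neg_mem' := fun {i} hi J₀ J₁ j hj =>
        (E.extOrthogonal_iff j _).2 fun A₀ A m₀ e₀ m e b h₀ h h1 h2 => by
          obtain ⟨k, hk⟩ := (E.extOrthogonal_iff j _).1 (hi j hj) m₀ e₀ m e b h₀ h h1 h2
          exact ⟨-k, by rw [Preadditive.comp_neg, hk]⟩ }
  comp_mem := fun {W X Y Z} k i f hi J₀ J₁ j hj =>
    (E.extOrthogonal_iff j _).2 fun A₀ A m₀ e₀ m e b h₀ h h1 h2 => by
      obtain ⟨B₀, g₀, n₀, d₀, sq₀, hd₀, c₀⟩ := h₀.exists_pushout k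
      obtain ⟨B, g, n, d, sq, hd, cc⟩ := h.exists_pushout k
      have hw : m₀ ≫ b ≫ g = k ≫ n := by rw [← Category.assoc, h1, sq.w]
      have w₀ : n₀ ≫ d₀ = 0 := c₀.choose
      have w : n ≫ d = 0 := cc.choose
      obtain ⟨t, ht⟩ := (E.extOrthogonal_iff j _).1 (hi j hj) n₀ d₀ n d
        (sq₀.desc (b ≫ g) n hw) c₀ cc (sq₀.inr_desc _ _ _) (by
          apply sq₀.hom_ext
          · rw [← Category.assoc, sq₀.inl_desc, Category.assoc, hd, h2, ← Category.assoc, hd₀]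
          · rw [← Category.assoc, sq₀.inr_desc, w, ← Category.assoc, w₀, zero_comp])
      exact ⟨g₀ ≫ t ≫ f, by
        rw [← Category.assoc, sq₀.w, Category.assoc, ← Category.assoc n₀, ht]⟩

/-- The ideal of injective morphisms, the right perpendicular of the ideal of all morphisms. -/
def injectiveIdeal : MorphismIdeal C := E.perp (MorphismIdeal.all C)

/-- Every object is the source of an inflation that is an injective morphism. -/
def HasEnoughInjectiveMorphisms : Prop :=
  ∀ A : C, ∃ (Q : C) (e : A ⟶ Q), E.IsInflation e ∧ e ∈ E.injectiveIdeal.hom A Q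

/-- `p : C₁ ⟶ A` is a special `I`-precover of `A` with `I`-syzygy `k : K₀ ⟶ K₁`: `p` lies in `I`,
`k` lies in the right perpendicular of `I`, and `p` is the deflation of a conflation
`K₁ ⟶ C₁ ⟶ A` that is the pushout along `k` of a conflation `K₀ ⟶ C₀ ⟶ A`. -/
def IsSpecialPrecoverWith (I : MorphismIdeal C) {A C₁ K₀ K₁ : C} (p : C₁ ⟶ A) (k : K₀ ⟶ K₁) :
    Prop :=
  p ∈ I.hom C₁ A ∧ k ∈ (E.perp I).hom K₀ K₁ ∧
    ∃ (C₀ : C) (m₀ : K₀ ⟶ C₀) (e₀ : C₀ ⟶ A) (m₁ : K₁ ⟶ C₁) (c : C₀ ⟶ C₁),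
      E.IsConflation m₀ e₀ ∧ E.IsConflation m₁ p ∧ IsPushout m₀ k c m₁ ∧ c ≫ p = e₀

/-- Every object has a special `I`-precover. -/
def IsSpecialPrecovering (I : MorphismIdeal C) : Prop :=
  ∀ A : C, ∃ (C₁ K₀ K₁ : C) (p : C₁ ⟶ A) (k : K₀ ⟶ K₁), E.IsSpecialPrecoverWith I p k

/-- `J` is an `I`-syzygy ideal: it lies in the right perpendicular of `I` and contains an
`I`-syzygy of every object. -/
def IsSyzygyIdeal (I J : MorphismIdeal C) : Prop :=
  J ≤ E.perp I ∧
    ∀ A : C, ∃ (C₁ K₀ K₁ : C) (p : C₁ ⟶ A) (k : K₀ ⟶ K₁),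
      E.IsSpecialPrecoverWith I p k ∧ k ∈ J.hom K₀ K₁

end ExactStructure

end IdealApprox

/-!
Read a conflation `ξ : K ⟶ B ⟶ X` as an element of `Ext (X, K)`, so that `k ∈ I^⊥` says `kξx = 0`
for all `ξ` and all `x ∈ I`, and `kξx = 0` says that `x` lifts through the deflation of the pushout
`kξ`. If `a = i ⋆ q` with `i ∈ J` and `q` injective, then `q` kills every conflation, so `aξ` is of
the form `jη` with `j ∈ J`. The morphisms `k` such that every `kξ` has this form are an ideal, which
therefore contains `J ⋄ E-inj`; it lies in `I^⊥` as soon as `J` does, and when it contains an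
`I`-syzygy `k` of `A`, rewriting the special precover `kξ` of `A` as `jη` gives a syzygy `j ∈ J`.

Conversely, embed the source of `k ∈ I^⊥` by an injective inflation `ε : X ⟶ Q` with cokernel `A`,
and pull back along `Q ⟶ A` a special `I`-precover `C₁ ⟶ A` whose syzygy lies in `J`. The morphism
`(ε, 0) : X ⟶ Q ×[A] C₁` is a restriction of an extension `s ⋆ ε` with `s ∈ J`, and `k` factors
through it because `C₁ ⟶ A` lies in `I`.
-/

namespace IdealApprox

namespace MorphismIdeal

variable {C : Type u} [Category.{v} C] [Preadditive C]

lemma comp_mem_left (I : MorphismIdeal C) {W X Y : C} (h : W ⟶ X) {g : X ⟶ Y}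
    (hg : g ∈ I.hom X Y) : h ≫ g ∈ I.hom W Y := by
  simpa using I.comp_mem h g (𝟙 Y) hg

lemma comp_mem_right (I : MorphismIdeal C) {X Y Z : C} {g : X ⟶ Y} (hg : g ∈ I.hom X Y)
    (f : Y ⟶ Z) : g ≫ f ∈ I.hom X Z := by
  simpa using I.comp_mem (𝟙 X) g f hg

lemma mem_span_of_mem {M : MorphismProperty C} {X Y : C} {f : X ⟶ Y} (hf : M f) :
    f ∈ (span M).hom X Y :=
  AddSubgroup.mem_iInf.2 fun K => K.2 f hf

lemma span_le {M : MorphismProperty C} {K : MorphismIdeal C}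
    (h : ∀ ⦃X Y : C⦄ (f : X ⟶ Y), M f → f ∈ K.hom X Y) : span M ≤ K :=
  fun _ _ _ hf => AddSubgroup.mem_iInf.1 hf ⟨K, h⟩

protected lemma le_trans {I J K : MorphismIdeal C} (hIJ : I ≤ J) (hJK : J ≤ K) : I ≤ K :=
  fun _ _ f hf => hJK f (hIJ f hf)

protected lemma le_antisymm {I J : MorphismIdeal C} (hIJ : I ≤ J) (hJI : J ≤ I) : I = J := by
  ext X Y f
  exact ⟨hIJ f, hJI f⟩

end MorphismIdeal

namespace ExactStructure

variable {C : Type u} [Category.{v} C] [Preadditive C] [HasFiniteBiproducts C]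
  {E : ExactStructure C}

namespace IsConflation

lemma comp_eq_zero {A B D : C} {m : A ⟶ B} {e : B ⟶ D} (h : E.IsConflation m e) : m ≫ e = 0 :=
  h.choose

lemma exists_lift {A B D T : C} {m : A ⟶ B} {e : B ⟶ D} (h : E.IsConflation m e) (f : T ⟶ B)
    (hf : f ≫ e = 0) : ∃ g : T ⟶ A, g ≫ m = f := by
  obtain ⟨w, h⟩ := h
  obtain ⟨hl⟩ := E.isKernel _ h
  obtain ⟨g, hg⟩ := KernelFork.IsLimit.lift' hl f hf
  exact ⟨g, hg⟩

lemma of_isLimit {A K B D : C} {κ : K ⟶ B} {m : A ⟶ B} {e : B ⟶ D} (h : E.IsConflation κ e)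
    {w : m ≫ e = 0} (hm : IsLimit (KernelFork.ofι m w)) : E.IsConflation m e := by
  obtain ⟨w', h⟩ := h
  obtain ⟨hκ⟩ := E.isKernel _ h
  let t : K ≅ A := hκ.conePointUniqueUpToIso hm
  have ht : t.hom ≫ m = κ := hκ.conePointUniqueUpToIso_hom_comp hm WalkingParallelPair.zero
  exact ⟨w, E.of_iso (ShortComplex.isoMk t (Iso.refl B) (Iso.refl D)
    (by simpa using ht) (by simp)) h⟩

lemma exists_pullback {A B D D' : C} {m : A ⟶ B} {e : B ⟶ D} (h : E.IsConflation m e)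
    (f : D' ⟶ D) :
    ∃ (P : C) (g : P ⟶ B) (e' : P ⟶ D') (m' : A ⟶ P),
      IsPullback g e' e f ∧ m' ≫ g = m ∧ E.IsConflation m' e' := by
  obtain ⟨P, g, e', sq, K, κ, hκ⟩ := E.pullback_deflation e f ⟨A, m, h⟩
  let m' : A ⟶ P := sq.lift m 0 (by rw [h.comp_eq_zero, zero_comp])
  have hm'g : m' ≫ g = m := sq.lift_fst _ _ _
  have hm'e : m' ≫ e' = 0 := sq.lift_snd _ _ _
  have : Mono m := h.mono
  have : Mono m' := mono_of_mono_fac hm'g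
  refine ⟨P, g, e', m', sq, hm'g, of_isLimit (w := hm'e) hκ (KernelFork.IsLimit.ofι' m' hm'e ?_)⟩
  intro T x hx
  have hl := h.exists_lift (x ≫ g) (by rw [Category.assoc, sq.w, ← Category.assoc, hx, zero_comp])
  refine ⟨hl.choose, sq.hom_ext ?_ ?_⟩
  · rw [Category.assoc, hm'g, hl.choose_spec]
  · rw [Category.assoc, hm'e, comp_zero, hx]

lemma exists_comp {A A' B D F : C} {m : A ⟶ B} {e : B ⟶ D} {m' : A' ⟶ D} {e' : D ⟶ F}
    (h : E.IsConflation m e) (h' : E.IsConflation m' e') :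
    ∃ (N : C) (n : N ⟶ B), E.IsConflation n (e ≫ e') :=
  E.comp_deflation e e' ⟨A, m, h⟩ ⟨A', m', h'⟩

end IsConflation

variable (E) in
/-- The vanishing `kξx = 0` in `Ext (X₀, M)`, where `ξ` is the class of the conflation
`K --m--> B --e--> X`. It is expressed without Yoneda classes: `k` extends along the inflation of
every conflation `xξ` that is a pullback of `ξ` along `x`. -/
def YonedaVanishes {K M B X X₀ : C} (m : K ⟶ B) (e : B ⟶ X) (k : K ⟶ M) (x : X₀ ⟶ X) : Prop :=
  ∀ ⦃B₀ : C⦄ (m₀ : K ⟶ B₀) (e₀ : B₀ ⟶ X₀) (b : B₀ ⟶ B),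
    E.IsConflation m₀ e₀ → m₀ ≫ b = m → b ≫ e = e₀ ≫ x → ∃ h : B₀ ⟶ M, m₀ ≫ h = k

lemma mem_perp_iff {I : MorphismIdeal C} {K M : C} {k : K ⟶ M} :
    k ∈ (E.perp I).hom K M ↔
      ∀ ⦃X₀ X : C⦄ (x : X₀ ⟶ X), x ∈ I.hom X₀ X →
        ∀ ⦃B : C⦄ (m : K ⟶ B) (e : B ⟶ X), E.IsConflation m e → E.YonedaVanishes m e k x := by
  constructor
  · intro hk X₀ X x hx B m e h B₀ m₀ e₀ b h₀ hm he
    exact (E.extOrthogonal_iff x k).1 (hk x hx) m₀ e₀ m e b h₀ h hm he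
  · intro hk X₀ X x hx
    exact (E.extOrthogonal_iff x k).2 fun B₀ B m₀ e₀ m e b h₀ h hm he =>
      hk x hx m e h m₀ e₀ b h₀ hm he

lemma exists_extension_of_mem_injectiveIdeal {A B X Q : C} {q : A ⟶ Q}
    (hq : q ∈ E.injectiveIdeal.hom A Q) {m : A ⟶ B} {e : B ⟶ X} (h : E.IsConflation m e) :
    ∃ f : B ⟶ Q, m ≫ f = q :=
  mem_perp_iff.1 hq (𝟙 X) (AddSubgroup.mem_top _) m e h m e (𝟙 B) h (Category.comp_id _)
    (by simp)

namespace YonedaVanishes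

variable {K M B X X₀ : C} {m : K ⟶ B} {e : B ⟶ X} {x : X₀ ⟶ X}

lemma inflation_comp (f : B ⟶ M) : E.YonedaVanishes m e (m ≫ f) x :=
  fun _ _ _ b _ hm _ => ⟨b ≫ f, by rw [← Category.assoc, hm]⟩

lemma add {k k' : K ⟶ M} (hk : E.YonedaVanishes m e k x) (hk' : E.YonedaVanishes m e k' x) :
    E.YonedaVanishes m e (k + k') x := by
  intro B₀ m₀ e₀ b h₀ hm he
  obtain ⟨t, rfl⟩ := hk m₀ e₀ b h₀ hm he
  obtain ⟨t', rfl⟩ := hk' m₀ e₀ b h₀ hm he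
  exact ⟨t + t', Preadditive.comp_add _ _ _ _ _ _⟩

lemma comp {k : K ⟶ M} (hk : E.YonedaVanishes m e k x) {M' : C} (f : M ⟶ M') :
    E.YonedaVanishes m e (k ≫ f) x := by
  intro B₀ m₀ e₀ b h₀ hm he
  obtain ⟨t, rfl⟩ := hk m₀ e₀ b h₀ hm he
  exact ⟨t ≫ f, (Category.assoc _ _ _).symm⟩

end YonedaVanishes

section MorphismOfConflations

variable {K K' B B' X X₀ : C} {m : K ⟶ B} {e : B ⟶ X} {m' : K' ⟶ B'} {e' : B' ⟶ X}
  {k : K ⟶ K'} {g : B ⟶ B'} {x : X₀ ⟶ X}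

/-- A morphism of conflations that is the identity on the right exhibits its target as the
pushout `kξ`. -/
lemma yonedaVanishes_iff_exists_lift (h : E.IsConflation m e) (h' : E.IsConflation m' e')
    (hm : m ≫ g = k ≫ m') (he : g ≫ e' = e) :
    E.YonedaVanishes m e k x ↔ ∃ y : X₀ ⟶ B', y ≫ e' = x := by
  constructor
  · intro hk
    obtain ⟨B₀, b, e₀, m₀, sq, hm₀, h₀⟩ := h.exists_pullback x
    obtain ⟨t, ht⟩ := hk m₀ e₀ b h₀ hm₀ sq.w
    have : Epi e₀ := h₀.epi
    obtain ⟨y, hy⟩ := h₀.exists_desc (b ≫ g - t ≫ m') (by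
      rw [Preadditive.comp_sub, ← Category.assoc, hm₀, ← Category.assoc, ht, hm, sub_self])
    refine ⟨y, ?_⟩
    rw [← cancel_epi e₀, ← Category.assoc, hy, Preadditive.sub_comp, Category.assoc, he,
      Category.assoc, h'.comp_eq_zero, comp_zero, sub_zero, sq.w]
  · rintro ⟨y, rfl⟩ B₀ m₀ e₀ b h₀ hm₀ he₀
    have : Mono m' := h'.mono
    obtain ⟨t, ht⟩ := h'.exists_lift (b ≫ g - e₀ ≫ y) (by
      rw [Preadditive.sub_comp, Category.assoc, Category.assoc, he, he₀, sub_self])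
    refine ⟨t, ?_⟩
    rw [← cancel_mono m', Category.assoc, ht, Preadditive.comp_sub, ← Category.assoc, hm₀, hm,
      ← Category.assoc, h₀.comp_eq_zero, zero_comp, sub_zero]

lemma yonedaVanishes_comp_iff (h : E.IsConflation m e) (h' : E.IsConflation m' e')
    (hm : m ≫ g = k ≫ m') (he : g ≫ e' = e) {M : C} (f : K' ⟶ M) :
    E.YonedaVanishes m e (k ≫ f) x ↔ E.YonedaVanishes m' e' f x := by
  obtain ⟨B'', g', m'', e'', sq, he'', h''⟩ := h'.exists_pushout f
  rw [yonedaVanishes_iff_exists_lift h' h'' sq.w he'']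
  apply yonedaVanishes_iff_exists_lift (g := g ≫ g') h h''
  · rw [← Category.assoc, hm, Category.assoc, sq.w, Category.assoc]
  · rw [Category.assoc, he'', he]

end MorphismOfConflations

/-- Lift `p` through the deflation of the pushout `kξ`, say to `y : Z ⟶ D`. The two maps from `P` to
`D`, through `Q` and through `y`, agree after the deflation, and their difference is `t`. -/
lemma YonedaVanishes.exists_factorization {X Q A Y Z P : C} {ε : X ⟶ Q} {π : Q ⟶ A} {k : X ⟶ Y}
    {p : Z ⟶ A} (hk : E.YonedaVanishes ε π k p) (hξ : E.IsConflation ε π) {q : P ⟶ Q}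
    {r : P ⟶ Z} (hqr : q ≫ π = r ≫ p) {x : X ⟶ P} (hxq : x ≫ q = ε) (hxr : x ≫ r = 0) :
    ∃ t : P ⟶ Y, x ≫ t = k := by
  obtain ⟨D, g, m, e, sq, hge, hD⟩ := hξ.exists_pushout k
  obtain ⟨y, hy⟩ := (yonedaVanishes_iff_exists_lift hξ hD sq.w hge).1 hk
  obtain ⟨t, ht⟩ := hD.exists_lift (q ≫ g - r ≫ y) (by
    rw [Preadditive.sub_comp, Category.assoc, Category.assoc, hge, hy, hqr, sub_self])
  have : Mono m := hD.mono
  refine ⟨t, ?_⟩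
  rw [← cancel_mono m, Category.assoc, ht, Preadditive.comp_sub, ← Category.assoc, hxq,
    ← Category.assoc, hxr, zero_comp, sub_zero, sq.w]

variable (E) in
/-- For the class `ξ` of `K --m--> B --e--> X`, the condition that `kξ` lies in `J · Ext (X, -)`. It
is encoded by annihilators: there are `j ∈ J` and a conflation `η` ending in `X` such that
`jηx = 0` implies `kξx = 0`. Applied to the deflation of the pushout `jη`, this implication makes
`kξ` a pushout of `jη`. -/
def IsDominatedBy (J : MorphismIdeal C) {K M B X : C} (m : K ⟶ B) (e : B ⟶ X) (k : K ⟶ M) :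
    Prop :=
  ∃ (N P L : C) (n : N ⟶ P) (p : P ⟶ X) (j : N ⟶ L), E.IsConflation n p ∧ j ∈ J.hom N L ∧
    ∀ ⦃X₀ : C⦄ (x : X₀ ⟶ X), E.YonedaVanishes n p j x → E.YonedaVanishes m e k x

namespace IsDominatedBy

variable {J : MorphismIdeal C} {K M B X : C} {m : K ⟶ B} {e : B ⟶ X}

lemma comp {k : K ⟶ M} (hk : E.IsDominatedBy J m e k) {M' : C} (f : M ⟶ M') :
    E.IsDominatedBy J m e (k ≫ f) := by
  obtain ⟨N, P, L, n, p, j, h, hj, hjk⟩ := hk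
  exact ⟨N, P, L, n, p, j, h, hj, fun _ x hx => (hjk x hx).comp f⟩

/-- If `kξ` and `k'ξ` are dominated by `jη` and `j'η'`, then `kξ + k'ξ` is dominated by
`(νj, ν'j')ζ`, where `ζ` is a common refinement: `νζ = η` and `ν'ζ = η'`. -/
lemma add {k k' : K ⟶ M} (hk : E.IsDominatedBy J m e k) (hk' : E.IsDominatedBy J m e k') :
    E.IsDominatedBy J m e (k + k') := by
  obtain ⟨N, P, L, n, p, j, h, hj, hjk⟩ := hk
  obtain ⟨N', P', L', n', p', j', h', hj', hjk'⟩ := hk'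
  obtain ⟨R, g, g', _, sq, -, hg'⟩ := h.exists_pullback p'
  obtain ⟨N'', n'', h''⟩ := hg'.exists_comp h'
  obtain ⟨ν, hν⟩ := h.exists_lift (n'' ≫ g) (by rw [Category.assoc, sq.w, h''.comp_eq_zero])
  obtain ⟨ν', hν'⟩ := h'.exists_lift (n'' ≫ g') (by rw [Category.assoc, h''.comp_eq_zero])
  have : HasBinaryBiproducts C := hasBinaryBiproducts_of_finite_biproducts C
  refine ⟨N'', R, L ⊞ L', n'', g' ≫ p', (ν ≫ j) ≫ biprod.inl + (ν' ≫ j') ≫ biprod.inr, h'',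
    add_mem (J.comp_mem_right (J.comp_mem_left ν hj) _)
      (J.comp_mem_right (J.comp_mem_left ν' hj') _), fun X₀ x hx => ?_⟩
  have hx_fst : E.YonedaVanishes n'' (g' ≫ p') (ν ≫ j) x := by simpa using hx.comp biprod.fst
  have hx_snd : E.YonedaVanishes n'' (g' ≫ p') (ν' ≫ j') x := by simpa using hx.comp biprod.snd
  exact (hjk x ((yonedaVanishes_comp_iff h'' h hν.symm sq.w j).1 hx_fst)).add
    (hjk' x ((yonedaVanishes_comp_iff h'' h' hν'.symm rfl j').1 hx_snd))

end IsDominatedBy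

variable (E) in
/-- The ideal of all `k : K ⟶ M` such that `kξ` lies in `J · Ext (X, -)` for every object `X` and
every `ξ` in `Ext (X, K)`, in the sense of `IsDominatedBy`. -/
def extClosure (J : MorphismIdeal C) : MorphismIdeal C where
  hom K M :=
    { carrier := {k | ∀ ⦃B X : C⦄ (m : K ⟶ B) (e : B ⟶ X), E.IsConflation m e →
        E.IsDominatedBy J m e k}
      zero_mem' := fun B X m e h =>
        ⟨K, B, M, m, e, 0, h, zero_mem _, fun _ _ hx => hx⟩
      add_mem' := fun hk hk' B X m e h => (hk m e h).add (hk' m e h)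
      neg_mem' := fun {k} hk B X m e h => by simpa using (hk m e h).comp (-𝟙 M) }
  comp_mem := fun f k f' hk B X m e h => by
    obtain ⟨B', b, m', e', sq, he', h'⟩ := h.exists_pushout f
    obtain ⟨N, P, L, n, p, j, hη, hj, hjk⟩ := (hk m' e' h').comp f'
    exact ⟨N, P, L, n, p, j, hη, hj,
      fun _ x hx => (yonedaVanishes_comp_iff h h' sq.w he' _).2 (hjk x hx)⟩

lemma extClosure_le_perp {I J : MorphismIdeal C} (hJ : J ≤ E.perp I) :
    E.extClosure J ≤ E.perp I := by
  intro K M k hk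
  refine mem_perp_iff.2 fun X₀ X x hx B m e h => ?_
  obtain ⟨N, P, L, n, p, j, hη, hj, hjk⟩ := hk m e h
  exact hjk x (mem_perp_iff.1 (hJ j hj) x hx n p hη)

/-- Since `q` is injective, `e₀ ≫ q` extends to some `f : B ⟶ J₁`. Pulling `I₀ ⟶ A ⟶ J₁` back along
`f` gives `α : P ⟶ A` and a conflation `η : N ⟶ P ⟶ X` with `γη = ξ`; on `N`, the morphisms `γ ≫ b`
and `ν ≫ m` differ by a morphism that extends to `P`, so `aξ = (γ ≫ b ≫ c)η = (ν ≫ i ≫ m₁)η`. -/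
lemma diamond_injectiveIdeal_le_extClosure (J : MorphismIdeal C) :
    E.diamond J E.injectiveIdeal ≤ E.extClosure J := by
  refine MorphismIdeal.span_le ?_
  rintro A₀ A₁ a ⟨I₀, I₁, J₀, J₁, i, q, hi, hq, m₀, e₀, m₁, e₁, hME⟩ B X μ π hξ
  obtain ⟨A, m, e, b, c, hA, -, hbe, hmc, -, rfl⟩ := hME.factor
  obtain ⟨f, hf⟩ := exists_extension_of_mem_injectiveIdeal
    (E.injectiveIdeal.comp_mem_left e₀ hq) hξ
  obtain ⟨P, α, β, _, sq, -, hβ⟩ := hA.exists_pullback f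
  obtain ⟨N, n, hη⟩ := hβ.exists_comp hξ
  obtain ⟨γ, hγ⟩ := hξ.exists_lift (n ≫ β) (by rw [Category.assoc, hη.comp_eq_zero])
  obtain ⟨ν, hν⟩ := hA.exists_lift (γ ≫ b - n ≫ α) (by
    rw [Preadditive.sub_comp, Category.assoc, hbe, ← hf, Category.assoc, sq.w,
      ← Category.assoc, hγ, Category.assoc, sub_self])
  have hγbc : γ ≫ b ≫ c = (ν ≫ i) ≫ m₁ + n ≫ α ≫ c := by
    rw [Category.assoc, ← hmc, ← Category.assoc ν, hν]
    simp
  refine ⟨N, P, I₁, n, β ≫ π, ν ≫ i, hη, J.comp_mem_left ν hi, fun X₀ x hx => ?_⟩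
  rw [← yonedaVanishes_comp_iff hη hξ hγ.symm rfl, hγbc]
  exact (hx.comp m₁).add (.inflation_comp (α ≫ c))

lemma isSyzygyIdeal_of_perp_le_extClosure {I J : MorphismIdeal C}
    (hI : E.IsSpecialPrecovering I) (hJ : J ≤ E.perp I) (h : E.perp I ≤ E.extClosure J) :
    E.IsSyzygyIdeal I J := by
  refine ⟨hJ, fun A => ?_⟩
  obtain ⟨C₁, K₀, K₁, q, k, hq, hk, C₀, m₀, e₀, m₁, c, h₀, h₁, sq, hc⟩ := hI A
  obtain ⟨N, P, L, n, p, j, hη, hj, hjk⟩ := h k hk m₀ e₀ h₀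
  obtain ⟨D, δ, l, d, sqD, hδ, hD⟩ := hη.exists_pushout j
  have hjd : E.YonedaVanishes n p j d :=
    (yonedaVanishes_iff_exists_lift hη hD sqD.w hδ).2 ⟨𝟙 D, Category.id_comp d⟩
  obtain ⟨y, rfl⟩ := (yonedaVanishes_iff_exists_lift h₀ h₁ sq.w hc).1 (hjk d hjd)
  exact ⟨D, N, L, y ≫ q, j,
    ⟨I.comp_mem_left y hq, hJ j hj, P, n, p, l, δ, hη, hD, sqD, hδ⟩, hj⟩

lemma comp_mem_diamond {I J : MorphismIdeal C} {I₀ I₁ A A₁ J₁ T : C} {m : I₀ ⟶ A} {e : A ⟶ J₁}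
    {m₁ : I₁ ⟶ A₁} {e₁ : A₁ ⟶ J₁} {i : I₀ ⟶ I₁} {c : A ⟶ A₁} (h : E.IsConflation m e)
    (h₁ : E.IsConflation m₁ e₁) (hmc : m ≫ c = i ≫ m₁) (hce : c ≫ e₁ = e)
    (hi : i ∈ I.hom I₀ I₁) {t : T ⟶ A} (ht : t ≫ e ∈ J.hom T J₁) :
    t ≫ c ∈ (E.diamond I J).hom T A₁ := by
  obtain ⟨A₀, b, e₀, m₀, sq, hm₀, h₀⟩ := h.exists_pullback (t ≫ e)
  have hbc : E.starClass I J (b ≫ c) :=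
    ⟨I₀, I₁, T, J₁, i, t ≫ e, hi, ht, m₀, e₀, m₁, e₁, h₀, h₁,
      by rw [← Category.assoc, hm₀, hmc], by rw [Category.assoc, hce, sq.w],
      A, m, e, b, c, h, hm₀, sq.w, hmc, hce, rfl⟩
  have htb : sq.lift t (𝟙 T) (Category.id_comp _).symm ≫ b = t := sq.lift_fst _ _ _
  rw [← htb, Category.assoc]
  exact MorphismIdeal.comp_mem_left _ _ (MorphismIdeal.mem_span_of_mem hbc)

lemma IsSyzygyIdeal.perp_le_diamond_injectiveIdeal {I J : MorphismIdeal C}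
    (hJ : E.IsSyzygyIdeal I J) (hE : E.HasEnoughInjectiveMorphisms) :
    E.perp I ≤ E.diamond J E.injectiveIdeal := by
  intro X Y k hk
  obtain ⟨Q, ε, ⟨A, π, (hξ : E.IsConflation ε π)⟩, hε⟩ := hE X
  obtain ⟨C₁, K₀, K₁, p, s, ⟨hp, -, C₀, m₀, e₀, m₁, c, h₀, h₁, sq, hc⟩, hs⟩ := hJ.2 A
  obtain ⟨P₀, r₀, q₀, z₀, pb₀, hz₀, hP₀⟩ := h₀.exists_pullback π
  obtain ⟨P, r, q, z, pb, hz, hP⟩ := h₁.exists_pullback π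
  let φ : P₀ ⟶ P := pb.lift (r₀ ≫ c) q₀ (by rw [Category.assoc, hc, pb₀.w])
  have hφr : φ ≫ r = r₀ ≫ c := pb.lift_fst _ _ _
  have hφq : φ ≫ q = q₀ := pb.lift_snd _ _ _
  have hzφ : z₀ ≫ φ = s ≫ z := by
    apply pb.hom_ext
    · rw [Category.assoc, hφr, ← Category.assoc, hz₀, sq.w, Category.assoc, hz]
    · rw [Category.assoc, hφq, hP₀.comp_eq_zero, Category.assoc, hP.comp_eq_zero, comp_zero]
  let σ : X ⟶ P₀ := pb₀.lift 0 ε (by rw [zero_comp, hξ.comp_eq_zero])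
  have hσr : σ ≫ r₀ = 0 := pb₀.lift_fst _ _ _
  have hσq : σ ≫ q₀ = ε := pb₀.lift_snd _ _ _
  have hσφ : σ ≫ φ ∈ (E.diamond J E.injectiveIdeal).hom X P :=
    comp_mem_diamond hP₀ hP hzφ hφq hs (hσq ▸ hε)
  obtain ⟨t, rfl⟩ := (mem_perp_iff.1 hk p hp ε π hξ).exists_factorization hξ pb.w.symm
    (x := σ ≫ φ) (by rw [Category.assoc, hφq, hσq])
    (by rw [Category.assoc, hφr, ← Category.assoc, hσr, zero_comp])
  exact MorphismIdeal.comp_mem_right _ hσφ t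

end ExactStructure

end IdealApprox

theorem mainTheorem10 {C : Type u} [Category.{v} C] [Preadditive C] [HasFiniteBiproducts C]
    (E : IdealApprox.ExactStructure C) (hE : E.HasEnoughInjectiveMorphisms)
    (I : IdealApprox.MorphismIdeal C) (hI : E.IsSpecialPrecovering I)
    (J : IdealApprox.MorphismIdeal C) (hJ : J ≤ E.perp I) :
    E.IsSyzygyIdeal I J ↔ E.diamond J E.injectiveIdeal = E.perp I := by
  have hclosure := IdealApprox.ExactStructure.diamond_injectiveIdeal_le_extClosure (E := E) J
  constructor
  · intro hsyz
    exact IdealApprox.MorphismIdeal.le_antisymm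
      (IdealApprox.MorphismIdeal.le_trans hclosure
        (IdealApprox.ExactStructure.extClosure_le_perp hJ))
      (hsyz.perp_le_diamond_injectiveIdeal hE)
  · intro heq
    exact IdealApprox.ExactStructure.isSyzygyIdeal_of_perp_le_extClosure hI hJ (heq ▸ hclosure)
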